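/- For integers $n\ge 1$ let $$d_n=\sum_{k=2}^n \binom{n}{k}(-1)^k\frac{1}{\zeta(k)}$$ be the differences of inverse zeta values, where $\zeta$ is the Riemann zeta function (the sum is empty, so $d_1=0$, for $n=1$). The following two assertions are equivalent. (FVBD hypothesis) For every $\epsilon>0$ there exists a constant $C_\epsilon>0$ such that $|d_n|<C_\epsilon\, n^{1/2+\epsilon}$ for all integers $n\ge 1$. (Riemann hypothesis) The (meromorphically continued) Riemann zeta function $\zeta(s)$ has no zeros in the half-plane $\Re(s)>\frac12$. -/

import Mathlib

/-- The differences of inverse zeta values,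
`d_n = ∑_{k=2}^n (n choose k) (-1)^k / ζ(k)` (an empty sum for `n < 2`). -/
noncomputable def invZetaDiff (n : ℕ) : ℂ :=
  ∑ k ∈ Finset.Icc 2 n, (n.choose k : ℂ) * (-1) ^ k * (1 / riemannZeta (k : ℂ))

/-- The growth hypothesis on the differences of inverse zeta values: for every `ε > 0` there is
a constant `C > 0` with `|d_n| < C n^(1/2 + ε)` for all `n ≥ 1`. -/
def FVBDHypothesis : Prop :=
  ∀ ε : ℝ, 0 < ε → ∃ C : ℝ, 0 < C ∧
    ∀ n : ℕ, 1 ≤ n → ‖invZetaDiff n‖ < C * (n : ℝ) ^ ((1 / 2 : ℝ) + ε)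

/-- The Riemann hypothesis, as absence of zeros of the Riemann zeta function in the half-plane
`Re s > 1/2`. The pole `s = 1` is excluded explicitly. -/
def ZetaZeroFreeHalfPlane : Prop :=
  ∀ s : ℂ, (1 / 2 : ℝ) < s.re → s ≠ 1 → riemannZeta s ≠ 0

/-!
Put `F(x) = ∑ μ(m) (exp (-x / m) - 1 + x / m)`. Expanding `1 / ζ(k) = ∑ μ(m) / m ^ k` and summing
the binomial series gives `d_n = ∑ μ(m) ((1 - 1 / m) ^ n - 1 + n / m)`, and replacing
`(1 - 1 / m) ^ n` by `exp (-n / m)` costs only `O(n ^ δ)` for every `δ > 0`; so `d_n` and `F` have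
the same growth exponent.

For `1 < Re s < 2` the Mellin transform of `F` at `-s` is `Γ(-s) / ζ(s)`. A bound
`F(x) = O(x ^ a)` makes this transform holomorphic for `a < Re s < 2`, and since `Γ` has no zeros,
neither does `ζ` there. Conversely, if `ζ` has no zeros for `Re s > θ`, Borel–Carathéodory applied
to `log ((s - 1) ζ(s))` bounds `1 / ((s - 1) ζ(s))` polynomially for `Re s ≥ θ + ε`; as `Γ` decays
faster than any polynomial on vertical lines, the contour of the Mellin inversion integral for `F`
can be moved to `Re s = θ + ε`, which yields `F(x) = O(x ^ (θ + ε))`.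
-/

open Filter Topology Asymptotics MeasureTheory Set
open scoped ArithmeticFunction.Moebius

/-- The growth hypothesis with an arbitrary exponent `θ` in place of `1 / 2`. -/
def InvZetaDiffGrowth (θ : ℝ) : Prop :=
  ∀ ε : ℝ, 0 < ε → ∃ C : ℝ, 0 < C ∧
    ∀ n : ℕ, 1 ≤ n → ‖invZetaDiff n‖ < C * (n : ℝ) ^ (θ + ε)

/-- The quasi-Riemann hypothesis: absence of zeros in the half-plane `Re s > θ`. As in
`ZetaZeroFreeHalfPlane`, the pole `s = 1` is excluded explicitly. -/
def ZetaZeroFreeRightOf (θ : ℝ) : Prop :=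
  ∀ s : ℂ, θ < s.re → s ≠ 1 → riemannZeta s ≠ 0

/-- The remainder `exp (-u) - 1 + u` of the exponential series after its linear term, the
continuous analogue of the binomial remainder `(1 - v) ^ n - 1 + n * v` with `u = n * v`. -/
noncomputable def expRem (u : ℝ) : ℝ := Real.exp (-u) - 1 + u

/-- The Möbius sum `∑ μ(m) (exp (-x / m) - 1 + x / m)`, which interpolates `invZetaDiff` up to a
small error and whose Mellin transform is explicit. -/
noncomputable def moebiusExpSum (x : ℝ) : ℂ := ∑' m : ℕ, (μ m : ℂ) * (expRem (x / m) : ℂ)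

/-! ### Exponential and binomial remainders -/

lemma le_rpow_of_le_rpow_of_le_rpow {u y p q a : ℝ} (hu : 0 < u) (hp : y ≤ u ^ p)
    (hq : y ≤ u ^ q) (hpa : p ≤ a) (haq : a ≤ q) : y ≤ u ^ a := by
  rcases le_total u 1 with h | h
  · exact hq.trans (Real.rpow_le_rpow_of_exponent_ge hu h haq)
  · exact hp.trans (Real.rpow_le_rpow_of_exponent_le h hpa)

lemma one_sub_exp_neg_le_rpow {u a : ℝ} (hu : 0 ≤ u) (h0 : 0 ≤ a) (h1 : a ≤ 1) :
    1 - Real.exp (-u) ≤ u ^ a := by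
  rcases hu.eq_or_lt with rfl | hu
  · simpa using Real.zero_rpow_nonneg a
  refine le_rpow_of_le_rpow_of_le_rpow hu (p := 0) (q := 1) ?_ ?_ h0 h1
  · simpa using (Real.exp_pos (-u)).le
  · rw [Real.rpow_one]
    linarith [Real.one_sub_le_exp_neg u]

lemma exp_neg_le_rpow_neg {u a : ℝ} (hu : 0 < u) (h0 : 0 ≤ a) (h1 : a ≤ 1) :
    Real.exp (-u) ≤ u ^ (-a) := by
  refine le_rpow_of_le_rpow_of_le_rpow hu (p := -1) (q := 0) ?_ ?_ (by linarith) (by linarith)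
  · rw [Real.rpow_neg_one, Real.exp_neg]
    exact inv_anti₀ hu (by linarith [Real.add_one_le_exp u])
  · simpa using hu.le

lemma expRem_zero : expRem 0 = 0 := by simp [expRem]

lemma expRem_nonneg (u : ℝ) : 0 ≤ expRem u := by
  unfold expRem
  linarith [Real.one_sub_le_exp_neg u]

lemma continuous_expRem : Continuous expRem := by
  unfold expRem
  fun_prop

lemma expRem_le_self {u : ℝ} (hu : 0 ≤ u) : expRem u ≤ u := by
  have : Real.exp (-u) ≤ 1 := Real.exp_le_one_iff.2 (by linarith)
  unfold expRem
  linarith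

lemma expRem_le_sq {u : ℝ} (hu : 0 ≤ u) : expRem u ≤ u ^ 2 := by
  rcases le_total u 1 with h | h
  · have := Real.abs_exp_sub_one_sub_id_le (x := -u) (by rwa [abs_neg, abs_of_nonneg hu])
    rw [neg_sq] at this
    unfold expRem
    linarith [le_abs_self (Real.exp (-u) - 1 - -u)]
  · nlinarith [expRem_le_self hu]

lemma expRem_le_rpow {u a : ℝ} (hu : 0 ≤ u) (h1 : 1 ≤ a) (h2 : a ≤ 2) : expRem u ≤ u ^ a := by
  rcases hu.eq_or_lt with rfl | hu'
  · rw [expRem_zero]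
    positivity
  · exact le_rpow_of_le_rpow_of_le_rpow hu' (by simpa using expRem_le_self hu)
      (by simpa using expRem_le_sq hu) h1 h2

lemma norm_ofReal_expRem (u : ℝ) : ‖(expRem u : ℂ)‖ = expRem u := by
  rw [Complex.norm_real, Real.norm_of_nonneg (expRem_nonneg u)]

lemma abs_expRem_sub_le {a b δ : ℝ} (ha : 0 ≤ a) (hab : a ≤ b) (h0 : 0 ≤ δ) (h1 : δ ≤ 1) :
    |expRem b - expRem a| ≤ (b - a) * b ^ δ := by
  have e_split : Real.exp (-a) = Real.exp (-b) * Real.exp (b - a) := by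
    rw [← Real.exp_add]
    congr 1
    ring
  have e_le : Real.exp (-a) ≤ 1 := Real.exp_le_one_iff.2 (by linarith)
  have e_diff_le : Real.exp (-a) - Real.exp (-b) ≤ b - a := by
    have := Real.one_sub_le_exp_neg (b - a)
    have e : Real.exp (-b) = Real.exp (-a) * Real.exp (-(b - a)) := by
      rw [← Real.exp_add]
      congr 1
      ring
    nlinarith [Real.exp_pos (-a)]
  have e_le_diff : Real.exp (-b) * (b - a) ≤ Real.exp (-a) - Real.exp (-b) := by
    nlinarith [Real.add_one_le_exp (b - a), Real.exp_pos (-b)]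
  rw [abs_of_nonneg (by unfold expRem; linarith)]
  calc expRem b - expRem a ≤ (b - a) * (1 - Real.exp (-b)) := by
        unfold expRem
        linarith
    _ ≤ (b - a) * b ^ δ := by
        gcongr
        exact one_sub_exp_neg_le_rpow (ha.trans hab) h0 h1

lemma exp_neg_pred_mul_le {n : ℕ} {v δ : ℝ} (hn : 1 ≤ n) (hv0 : 0 < v) (hv1 : v ≤ 1)
    (h0 : 0 ≤ δ) (h1 : δ ≤ 1) :
    Real.exp (-v) ^ (n - 1) ≤ 3 * (n * v) ^ (δ - 1) := by
  have hnv : 0 < n * v := by positivity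
  have e_split : Real.exp (-v) ^ (n - 1) = Real.exp v * Real.exp (-(n * v)) := by
    rw [← Real.exp_nat_mul, ← Real.exp_add]
    congr 1
    push_cast [hn]
    ring
  have e_le : Real.exp v ≤ 3 := (Real.exp_le_exp.2 hv1).trans (by linarith [Real.exp_one_lt_d9])
  rw [e_split, ← neg_sub 1 δ]
  gcongr
  exact exp_neg_le_rpow_neg hnv (by linarith) (by linarith)

lemma abs_one_sub_pow_sub_exp_le {n : ℕ} {v δ : ℝ} (hn : 1 ≤ n) (hv0 : 0 < v) (hv1 : v ≤ 1)
    (h0 : 0 ≤ δ) (h1 : δ ≤ 1) :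
    |(1 - v) ^ n - Real.exp (-(n * v))| ≤ 3 * (n : ℝ) ^ δ * v ^ (1 + δ) := by
  have hn0 : (0 : ℝ) < n := by positivity
  have hle : 1 - v ≤ Real.exp (-v) := Real.one_sub_le_exp_neg v
  have hdiff : |1 - v - Real.exp (-v)| ≤ v ^ 2 := by
    rw [abs_sub_comm, abs_of_nonneg (by linarith)]
    refine le_trans (le_of_eq ?_) (expRem_le_sq hv0.le)
    rw [expRem]
    ring
  have hpow : Real.exp (-(n * v)) = Real.exp (-v) ^ n := by
    rw [← Real.exp_nat_mul, mul_neg]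
  rw [hpow]
  calc |(1 - v) ^ n - Real.exp (-v) ^ n|
      ≤ |1 - v - Real.exp (-v)| * n * max |1 - v| |Real.exp (-v)| ^ (n - 1) :=
        abs_pow_sub_pow_le _ _ n
    _ = |1 - v - Real.exp (-v)| * n * Real.exp (-v) ^ (n - 1) := by
        rw [abs_of_nonneg (by linarith : 0 ≤ 1 - v), Real.abs_exp, max_eq_right hle]
    _ ≤ v ^ 2 * n * (3 * (n * v) ^ (δ - 1)) := by
        gcongr
        exact exp_neg_pred_mul_le hn hv0 hv1 h0 h1
    _ = 3 * (n : ℝ) ^ δ * v ^ (1 + δ) := by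
        rw [Real.mul_rpow hn0.le hv0.le, Real.rpow_sub hn0, Real.rpow_sub hv0, Real.rpow_add hv0,
          Real.rpow_one, Real.rpow_one]
        field_simp

lemma abs_binomial_rem_sub_expRem_le {n : ℕ} {x v δ : ℝ} (hn : 1 ≤ n) (hnx : n ≤ x)
    (hxn : x ≤ n + 1) (hv0 : 0 < v) (hv1 : v ≤ 1) (h0 : 0 ≤ δ) (h1 : δ ≤ 1) :
    |((1 - v) ^ n - 1 + n * v) - expRem (x * v)| ≤ 4 * x ^ δ * v ^ (1 + δ) := by
  have hx : 0 ≤ x := (Nat.cast_nonneg n).trans hnx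
  have hbinomial : |(1 - v) ^ n - Real.exp (-(n * v))| ≤ 3 * x ^ δ * v ^ (1 + δ) :=
    (abs_one_sub_pow_sub_exp_le hn hv0 hv1 h0 h1).trans (by gcongr)
  have hround : |expRem (x * v) - expRem (n * v)| ≤ x ^ δ * v ^ (1 + δ) :=
    calc |expRem (x * v) - expRem (n * v)| ≤ (x * v - n * v) * (x * v) ^ δ :=
          abs_expRem_sub_le (by positivity) (by gcongr) h0 h1
      _ ≤ v * (x * v) ^ δ := by
          gcongr
          nlinarith
      _ = x ^ δ * v ^ (1 + δ) := by
          rw [Real.mul_rpow hx hv0.le, Real.rpow_add hv0, Real.rpow_one]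
          ring
  have hsplit : ((1 - v) ^ n - 1 + n * v) - expRem (x * v) =
      ((1 - v) ^ n - Real.exp (-(n * v))) - (expRem (x * v) - expRem (n * v)) := by
    simp only [expRem]
    ring
  rw [hsplit]
  exact (abs_sub _ _).trans (by linarith)

/-! ### Möbius sums -/

lemma norm_moebius_le (m : ℕ) : ‖(μ m : ℂ)‖ ≤ 1 := by
  rw [Complex.norm_intCast]
  exact_mod_cast ArithmeticFunction.abs_moebius_le_one

lemma norm_moebius_mul_le {f : ℕ → ℂ} {B a : ℝ} (ha : a ≠ 0)
    (hf : ∀ m : ℕ, m ≠ 0 → ‖f m‖ ≤ B * (1 / (m : ℝ) ^ a)) (m : ℕ) :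
    ‖(μ m : ℂ) * f m‖ ≤ B * (1 / (m : ℝ) ^ a) := by
  rcases eq_or_ne m 0 with rfl | hm
  · simp [Real.zero_rpow ha]
  · rw [norm_mul]
    exact (mul_le_of_le_one_left (norm_nonneg _) (norm_moebius_le m)).trans (hf m hm)

lemma summable_moebius_mul {f : ℕ → ℂ} {B a : ℝ} (ha : 1 < a)
    (hf : ∀ m : ℕ, m ≠ 0 → ‖f m‖ ≤ B * (1 / (m : ℝ) ^ a)) :
    Summable fun m ↦ (μ m : ℂ) * f m :=
  .of_norm_bounded ((Real.summable_one_div_nat_rpow.2 ha).mul_left B)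
    (norm_moebius_mul_le (by linarith) hf)

lemma norm_tsum_moebius_mul_le {f : ℕ → ℂ} {B a : ℝ} (ha : 1 < a)
    (hf : ∀ m : ℕ, m ≠ 0 → ‖f m‖ ≤ B * (1 / (m : ℝ) ^ a)) :
    ‖∑' m, (μ m : ℂ) * f m‖ ≤ B * ∑' m : ℕ, 1 / (m : ℝ) ^ a := by
  rw [← tsum_mul_left]
  exact tsum_of_norm_bounded ((Real.summable_one_div_nat_rpow.2 ha).mul_left B).hasSum
    (norm_moebius_mul_le (by linarith) hf)

lemma hasSum_moebius_mul_cpow {s : ℂ} (hs : 1 < s.re) :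
    HasSum (fun m : ℕ ↦ (μ m : ℂ) * (m : ℂ) ^ (-s)) (1 / riemannZeta s) := by
  have hsum := (ArithmeticFunction.LSeriesSummable_moebius_iff.2 hs).LSeriesHasSum
  have hval : LSeries (fun n ↦ ((μ n : ℤ) : ℂ)) s = 1 / riemannZeta s := by
    rw [eq_div_iff (riemannZeta_ne_zero_of_one_lt_re hs), mul_comm,
      ← LSeries_one_eq_riemannZeta hs]
    exact LSeries_one_mul_Lseries_moebius hs
  rw [LSeriesHasSum, hval] at hsum
  convert hsum using 2 with m
  rcases eq_or_ne m 0 with rfl | hm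
  · simp
  · rw [LSeries.term_of_ne_zero hm, Complex.cpow_neg, div_eq_mul_inv]

lemma norm_one_div_riemannZeta_le {s : ℂ} (hs : 1 < s.re) :
    ‖1 / riemannZeta s‖ ≤ ∑' m : ℕ, 1 / (m : ℝ) ^ s.re := by
  rw [← (hasSum_moebius_mul_cpow hs).tsum_eq]
  refine (norm_tsum_moebius_mul_le hs fun m hm ↦ le_of_eq ?_).trans_eq (one_mul _)
  rw [Complex.norm_natCast_cpow_of_pos (Nat.pos_of_ne_zero hm), Complex.neg_re,
    Real.rpow_neg (Nat.cast_nonneg m), one_mul, one_div]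

lemma sum_Icc_two_choose_mul_pow {R : Type*} [CommRing R] {n : ℕ} (hn : 1 ≤ n) (y : R) :
    ∑ k ∈ Finset.Icc 2 n, (n.choose k : R) * (-1) ^ k * y ^ k = (1 - y) ^ n - 1 + n * y := by
  have hbinom : (1 - y) ^ n = ∑ k ∈ Finset.range (n + 1), (n.choose k : R) * (-1) ^ k * y ^ k := by
    rw [sub_eq_neg_add, add_pow]
    refine Finset.sum_congr rfl fun k _ ↦ ?_
    rw [neg_pow]
    ring
  have hrange : Finset.range (n + 1) = insert 0 (insert 1 (Finset.Icc 2 n)) := by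
    ext k
    simp only [Finset.mem_range, Finset.mem_insert, Finset.mem_Icc]
    omega
  rw [hbinom, hrange, Finset.sum_insert (by simp), Finset.sum_insert (by simp)]
  simp

lemma hasSum_invZetaDiff {n : ℕ} (hn : 1 ≤ n) :
    HasSum (fun m : ℕ ↦ (μ m : ℂ) * ((1 - 1 / (m : ℂ)) ^ n - 1 + n * (1 / (m : ℂ))))
      (invZetaDiff n) := by
  have hpow {k : ℕ} (hk : k ∈ Finset.Icc 2 n) :
      HasSum (fun m : ℕ ↦ (μ m : ℂ) * (1 / (m : ℂ)) ^ k) (1 / riemannZeta k) := by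
    have hk' : 1 < (k : ℂ).re := by
      rw [Complex.natCast_re]
      exact_mod_cast (Finset.mem_Icc.1 hk).1
    simpa [Complex.cpow_neg] using hasSum_moebius_mul_cpow hk'
  have hsum : HasSum (fun m : ℕ ↦ ∑ k ∈ Finset.Icc 2 n,
      (n.choose k : ℂ) * (-1) ^ k * ((μ m : ℂ) * (1 / (m : ℂ)) ^ k)) (invZetaDiff n) :=
    hasSum_sum fun k hk ↦ (hpow hk).mul_left _
  convert hsum using 2 with m
  rw [← sum_Icc_two_choose_mul_pow hn, Finset.mul_sum]
  exact Finset.sum_congr rfl fun k _ ↦ by ring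

lemma norm_expRem_div_le {x a : ℝ} (hx : 0 ≤ x) (h1 : 1 ≤ a) (h2 : a ≤ 2) (m : ℕ) :
    ‖(expRem (x / m) : ℂ)‖ ≤ x ^ a * (1 / (m : ℝ) ^ a) := by
  rw [norm_ofReal_expRem, mul_one_div, ← Real.div_rpow hx (Nat.cast_nonneg m)]
  exact expRem_le_rpow (by positivity) h1 h2

lemma summable_moebiusExpSum {x : ℝ} (hx : 0 ≤ x) :
    Summable fun m : ℕ ↦ (μ m : ℂ) * (expRem (x / m) : ℂ) :=
  summable_moebius_mul one_lt_two fun m _ ↦ norm_expRem_div_le hx one_le_two le_rfl m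

lemma norm_moebiusExpSum_le {x a : ℝ} (hx : 0 ≤ x) (h1 : 1 < a) (h2 : a ≤ 2) :
    ‖moebiusExpSum x‖ ≤ x ^ a * ∑' m : ℕ, 1 / (m : ℝ) ^ a :=
  norm_tsum_moebius_mul_le h1 fun m _ ↦ norm_expRem_div_le hx h1.le h2 m

lemma continuousOn_moebiusExpSum : ContinuousOn moebiusExpSum (Ioi 0) := by
  intro x hx
  have hIcc : ContinuousOn moebiusExpSum (Icc 0 (x + 1)) := by
    refine continuousOn_tsum (u := fun m : ℕ ↦ (x + 1) ^ (2 : ℝ) * (1 / (m : ℝ) ^ (2 : ℝ)))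
      (fun m ↦ ?_) ((Real.summable_one_div_nat_rpow.2 one_lt_two).mul_left _) fun m y hy ↦ ?_
    · have := continuous_expRem
      fun_prop
    · refine norm_moebius_mul_le (f := fun m ↦ (expRem (y / m) : ℂ)) two_ne_zero (fun m _ ↦ ?_) m
      refine (norm_expRem_div_le hy.1 one_le_two le_rfl m).trans ?_
      have := hy.1
      gcongr
      exact hy.2
  exact (hIcc.continuousAt (Icc_mem_nhds hx (lt_add_one x))).continuousWithinAt

lemma locallyIntegrableOn_moebiusExpSum : LocallyIntegrableOn moebiusExpSum (Ioi 0) :=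
  continuousOn_moebiusExpSum.locallyIntegrableOn measurableSet_Ioi

lemma norm_invZetaDiff_sub_moebiusExpSum_le {n : ℕ} {x δ : ℝ} (hn : 1 ≤ n) (hnx : n ≤ x)
    (hxn : x ≤ n + 1) (h0 : 0 < δ) (h1 : δ ≤ 1) :
    ‖invZetaDiff n - moebiusExpSum x‖ ≤ 4 * x ^ δ * ∑' m : ℕ, 1 / (m : ℝ) ^ (1 + δ) := by
  have hx : 0 ≤ x := (Nat.cast_nonneg n).trans hnx
  have hdiff := (hasSum_invZetaDiff hn).sub (summable_moebiusExpSum hx).hasSum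
  simp only [← mul_sub] at hdiff
  rw [moebiusExpSum, ← hdiff.tsum_eq]
  refine norm_tsum_moebius_mul_le (by linarith) fun m hm ↦ ?_
  have hm0 : (0 : ℝ) < m := by positivity
  have hm1 : 1 / (m : ℝ) ≤ 1 :=
    div_le_one_of_le₀ (Nat.one_le_cast.2 (Nat.one_le_iff_ne_zero.2 hm)) hm0.le
  have hterm := abs_binomial_rem_sub_expRem_le hn hnx hxn (one_div_pos.2 hm0) hm1 h0.le h1
  rw [Real.div_rpow zero_le_one hm0.le, Real.one_rpow, mul_one_div x, ← Real.norm_eq_abs,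
    ← Complex.norm_real] at hterm
  push_cast at hterm
  exact hterm

lemma invZetaDiff_floor_sub_moebiusExpSum_isBigO {δ : ℝ} (h0 : 0 < δ) (h1 : δ ≤ 1) :
    (fun x : ℝ ↦ invZetaDiff ⌊x⌋₊ - moebiusExpSum x) =O[atTop] fun x ↦ x ^ δ := by
  refine IsBigO.of_bound (4 * ∑' m : ℕ, 1 / (m : ℝ) ^ (1 + δ)) ?_
  filter_upwards [eventually_ge_atTop 1] with x hx
  rw [Real.norm_of_nonneg (by positivity), mul_right_comm]
  exact norm_invZetaDiff_sub_moebiusExpSum_le (Nat.one_le_floor_iff x |>.2 hx)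
    (Nat.floor_le (by linarith)) (Nat.lt_floor_add_one x).le h0 h1

lemma isBigO_rpow_rpow_atTop {p q : ℝ} (hpq : p ≤ q) :
    (fun x : ℝ ↦ x ^ p) =O[atTop] fun x ↦ x ^ q := by
  refine IsBigO.of_bound 1 ?_
  filter_upwards [eventually_ge_atTop 1] with x hx
  rw [one_mul, Real.norm_of_nonneg (by positivity), Real.norm_of_nonneg (by positivity)]
  exact Real.rpow_le_rpow_of_exponent_le hx hpq

lemma invZetaDiffGrowth_iff_floor_isBigO {θ : ℝ} (hθ : 0 ≤ θ) :
    InvZetaDiffGrowth θ ↔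
      ∀ ε : ℝ, 0 < ε → (fun x : ℝ ↦ invZetaDiff ⌊x⌋₊) =O[atTop] fun x ↦ x ^ (θ + ε) := by
  refine forall₂_congr fun ε hε ↦ ⟨fun ⟨C, hC, hbound⟩ ↦ ?_, fun h ↦ ?_⟩
  · refine IsBigO.of_bound C ?_
    filter_upwards [eventually_ge_atTop 1] with x hx
    rw [Real.norm_of_nonneg (by positivity)]
    refine (hbound _ (Nat.one_le_floor_iff x |>.2 hx)).le.trans ?_
    gcongr
    exact Nat.floor_le (by linarith)
  · have hnat : invZetaDiff =O[atTop] fun n : ℕ ↦ (n : ℝ) ^ (θ + ε) := by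
      simpa [Function.comp_def] using h.comp_tendsto tendsto_natCast_atTop_atTop
    obtain ⟨C, hC, hbound⟩ := bound_of_isBigO_nat_atTop hnat
    refine ⟨C + 1, by positivity, fun n hn ↦ ?_⟩
    have hpos : 0 < (n : ℝ) ^ (θ + ε) := by positivity
    have hn_bound := hbound hpos.ne'
    rw [Real.norm_of_nonneg hpos.le] at hn_bound
    linarith

lemma invZetaDiffGrowth_iff_moebiusExpSum_isBigO {θ : ℝ} (hθ : 0 ≤ θ) :
    InvZetaDiffGrowth θ ↔
      ∀ ε : ℝ, 0 < ε → moebiusExpSum =O[atTop] fun x : ℝ ↦ x ^ (θ + ε) := by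
  rw [invZetaDiffGrowth_iff_floor_isBigO hθ]
  refine forall₂_congr fun ε hε ↦ ?_
  have hdiff : (fun x : ℝ ↦ invZetaDiff ⌊x⌋₊ - moebiusExpSum x) =O[atTop] fun x ↦ x ^ (θ + ε) :=
    (invZetaDiff_floor_sub_moebiusExpSum_isBigO (lt_min hε one_pos) (min_le_right ε 1)).trans
      (isBigO_rpow_rpow_atTop (by linarith [min_le_left ε 1]))
  exact ⟨fun h ↦ by simpa using h.sub hdiff, fun h ↦ by simpa using h.add hdiff⟩

/-! ### Mellin transforms -/

lemma isBigO_rpow_of_le {l : Filter ℝ} (hl : ∀ᶠ x in l, 0 < x) {g : ℝ → ℂ} {C a : ℝ}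
    (h : ∀ x : ℝ, 0 < x → ‖g x‖ ≤ C * x ^ a) : g =O[l] fun x ↦ x ^ a := by
  refine IsBigO.of_bound C ?_
  filter_upwards [hl] with x hx
  rw [Real.norm_of_nonneg (by positivity)]
  exact h x hx

lemma cpow_mul_isBigO_rpow {l : Filter ℝ} (hl : ∀ᶠ x in l, 0 < x) {g : ℝ → ℂ} {a : ℝ} {w : ℂ}
    (hg : g =O[l] fun x ↦ x ^ (-a)) :
    (fun x : ℝ ↦ (x : ℂ) ^ w * g x) =O[l] fun x ↦ x ^ (w.re - a) := by
  have hcpow : (fun x : ℝ ↦ (x : ℂ) ^ w) =O[l] fun x : ℝ ↦ x ^ w.re :=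
    isBigO_rpow_of_le (C := 1) hl fun x hx ↦ by
      rw [Complex.norm_cpow_eq_rpow_re_of_pos hx, one_mul]
  refine (hcpow.mul hg).congr' EventuallyEq.rfl ?_
  filter_upwards [hl] with x hx
  rw [← Real.rpow_add hx, sub_eq_add_neg]

lemma mellin_deriv_add_one {g g' : ℝ → ℂ} {a b : ℝ} {w : ℂ}
    (hd : ∀ x : ℝ, 0 < x → HasDerivAt g (g' x) x)
    (htop : g =O[atTop] fun x : ℝ ↦ x ^ (-a)) (hwa : w.re < a)
    (hbot : g =O[𝓝[>] 0] fun x : ℝ ↦ x ^ (-b)) (hwb : b < w.re)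
    (hg' : MellinConvergent g' (w + 1)) :
    mellin g' (w + 1) = -w * mellin g w := by
  have hg : MellinConvergent g w :=
    mellinConvergent_of_isBigO_rpow
      (ContinuousOn.locallyIntegrableOn
        (fun x hx ↦ (hd x hx).continuousAt.continuousWithinAt) measurableSet_Ioi)
      htop hwa hbot hwb
  have boundary_zero : Tendsto ((fun x : ℝ ↦ (x : ℂ) ^ w) * g) (𝓝[>] 0) (𝓝 0) := by
    refine (cpow_mul_isBigO_rpow self_mem_nhdsWithin hbot).trans_tendsto ?_
    have hcont := Real.continuousAt_rpow_const 0 (w.re - b) (Or.inr (by linarith))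
    rw [ContinuousAt, Real.zero_rpow (by linarith)] at hcont
    exact hcont.mono_left nhdsWithin_le_nhds
  have boundary_top : Tendsto ((fun x : ℝ ↦ (x : ℂ) ^ w) * g) atTop (𝓝 0) := by
    refine (cpow_mul_isBigO_rpow (eventually_gt_atTop 0) htop).trans_tendsto ?_
    simpa using tendsto_rpow_neg_atTop (y := a - w.re) (by linarith)
  have hcpow (x : ℝ) (hx : x ∈ Ioi (0 : ℝ)) :
      HasDerivAt (fun x : ℝ ↦ (x : ℂ) ^ w) (w * (x : ℂ) ^ (w - 1)) x := by
    have h := (hasDerivAt_id (x : ℂ)).cpow_const (c := w) (Or.inl (by simpa using hx))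
    simpa using h.comp_ofReal
  have hparts := integral_Ioi_mul_deriv_eq_deriv_mul hcpow hd
    (by simpa [MellinConvergent, Pi.mul_def] using hg')
    (by simpa [MellinConvergent, Pi.mul_def, mul_assoc, IntegrableOn] using hg.const_mul w)
    boundary_zero boundary_top
  simp only [mul_assoc, integral_const_mul] at hparts
  simpa [mellin] using hparts

lemma one_sub_cexp_neg_isBigO {l : Filter ℝ} (hl : ∀ᶠ x in l, 0 < x) {a : ℝ} (h0 : 0 ≤ a)
    (h1 : a ≤ 1) : (fun x : ℝ ↦ 1 - Complex.exp (-x)) =O[l] fun x ↦ x ^ a := by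
  refine isBigO_rpow_of_le (C := 1) hl fun x hx ↦ ?_
  have hreal : 1 - Complex.exp (-x) = ((1 - Real.exp (-x) : ℝ) : ℂ) := by push_cast; rfl
  have hle : Real.exp (-x) ≤ 1 := Real.exp_le_one_iff.2 (by linarith)
  rw [hreal, Complex.norm_real, Real.norm_of_nonneg (by linarith), one_mul]
  exact one_sub_exp_neg_le_rpow hx.le h0 h1

lemma ofReal_expRem_isBigO {l : Filter ℝ} (hl : ∀ᶠ x in l, 0 < x) {a : ℝ} (h1 : 1 ≤ a)
    (h2 : a ≤ 2) : (fun x ↦ (expRem x : ℂ)) =O[l] fun x ↦ x ^ a := by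
  refine isBigO_rpow_of_le (C := 1) hl fun x hx ↦ ?_
  rw [norm_ofReal_expRem, one_mul]
  exact expRem_le_rpow hx.le h1 h2

lemma mellinConvergent_one_sub_cexp_neg {w : ℂ} (h1 : -1 < w.re) (h2 : w.re < 0) :
    MellinConvergent (fun x : ℝ ↦ 1 - Complex.exp (-x)) w :=
  mellinConvergent_of_isBigO_rpow (a := 0) (b := -1)
    (Continuous.locallyIntegrable (by fun_prop) |>.locallyIntegrableOn _)
    (one_sub_cexp_neg_isBigO (eventually_gt_atTop 0) (by norm_num) (by norm_num)) h2
    (one_sub_cexp_neg_isBigO self_mem_nhdsWithin (by norm_num) (by norm_num)) h1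

lemma mellinConvergent_expRem {w : ℂ} (h1 : -2 < w.re) (h2 : w.re < -1) :
    MellinConvergent (fun x ↦ (expRem x : ℂ)) w :=
  mellinConvergent_of_isBigO_rpow (a := -1) (b := -2)
    ((Complex.continuous_ofReal.comp continuous_expRem).locallyIntegrable.locallyIntegrableOn _)
    (ofReal_expRem_isBigO (eventually_gt_atTop 0) (by norm_num) (by norm_num)) h2
    (ofReal_expRem_isBigO self_mem_nhdsWithin (by norm_num) (by norm_num)) h1

lemma mellin_one_sub_cexp_neg {w : ℂ} (h1 : -1 < w.re) (h2 : w.re < 0) :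
    mellin (fun x : ℝ ↦ 1 - Complex.exp (-x)) w = -Complex.Gamma w := by
  have hw : w ≠ 0 := by rintro rfl; simp at h2
  have hre : 0 < (w + 1).re := by simpa using by linarith
  have hconv : MellinConvergent (fun x : ℝ ↦ Complex.exp (-x)) (w + 1) := by
    simpa [MellinConvergent, mul_comm] using Complex.GammaIntegral_convergent hre
  have hderiv (x : ℝ) : HasDerivAt (fun x : ℝ ↦ 1 - Complex.exp (-x)) (Complex.exp (-x)) x := by
    simpa using ((hasDerivAt_id (x : ℂ)).neg.cexp.const_sub 1).comp_ofReal
  have hparts := mellin_deriv_add_one (a := 0) (b := -1) (fun x _ ↦ hderiv x)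
    (one_sub_cexp_neg_isBigO (eventually_gt_atTop 0) (by norm_num) (by norm_num)) h2
    (one_sub_cexp_neg_isBigO self_mem_nhdsWithin (by norm_num) (by norm_num)) h1 hconv
  have hGamma : mellin (fun x : ℝ ↦ Complex.exp (-x)) (w + 1) = w * Complex.Gamma w := by
    rw [← Complex.Gamma_add_one w hw, Complex.Gamma_eq_integral hre,
      Complex.GammaIntegral_eq_mellin]
    simp
  exact mul_left_cancel₀ hw (by linear_combination hparts - hGamma)

lemma mellin_expRem {w : ℂ} (h1 : -2 < w.re) (h2 : w.re < -1) :
    mellin (fun x ↦ (expRem x : ℂ)) w = Complex.Gamma w := by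
  have hw : w ≠ 0 := by rintro rfl; norm_num at h2
  have hre1 : -1 < (w + 1).re := by simpa using by linarith
  have hre2 : (w + 1).re < 0 := by simpa using by linarith
  have hderiv (x : ℝ) : HasDerivAt (fun x ↦ (expRem x : ℂ)) (1 - Complex.exp (-x)) x := by
    convert (((hasDerivAt_id (x : ℂ)).neg.cexp.sub_const 1).add
      (hasDerivAt_id (x : ℂ))).comp_ofReal using 1
    · ext y
      simp [expRem]
    · simp only [Pi.neg_apply, id_eq, mul_neg, mul_one]
      ring
  have hparts := mellin_deriv_add_one (a := -1) (b := -2) (fun x _ ↦ hderiv x)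
    (ofReal_expRem_isBigO (eventually_gt_atTop 0) (by norm_num) (by norm_num)) h2
    (ofReal_expRem_isBigO self_mem_nhdsWithin (by norm_num) (by norm_num)) h1
    (mellinConvergent_one_sub_cexp_neg hre1 hre2)
  rw [mellin_one_sub_cexp_neg hre1 hre2, Complex.Gamma_add_one w hw] at hparts
  exact mul_left_cancel₀ hw (by linear_combination hparts)

section Scaling

variable {E : Type*} [NormedAddCommGroup E] [NormedSpace ℂ E] {g : ℝ → E} {w : ℂ}

lemma integral_norm_cpow_smul_comp_mul_left (g : ℝ → E) (w : ℂ) {p : ℝ} (hp : 0 < p) :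
    ∫ x in Ioi (0 : ℝ), ‖(x : ℂ) ^ (w - 1) • g (p * x)‖ =
      p ^ (-w.re) * ∫ x in Ioi (0 : ℝ), ‖(x : ℂ) ^ (w - 1) • g x‖ := by
  have hscale : ∫ x in Ioi (0 : ℝ), ‖((p * x : ℝ) : ℂ) ^ (w - 1) • g (p * x)‖ =
      p⁻¹ * ∫ x in Ioi (0 : ℝ), ‖(x : ℂ) ^ (w - 1) • g x‖ := by
    simpa using integral_comp_mul_left_Ioi (fun x : ℝ ↦ ‖(x : ℂ) ^ (w - 1) • g x‖) 0 hp
  have hpull : ∫ x in Ioi (0 : ℝ), ‖((p * x : ℝ) : ℂ) ^ (w - 1) • g (p * x)‖ =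
      p ^ (w.re - 1) * ∫ x in Ioi (0 : ℝ), ‖(x : ℂ) ^ (w - 1) • g (p * x)‖ := by
    rw [← integral_const_mul]
    refine setIntegral_congr_fun measurableSet_Ioi fun x hx ↦ ?_
    simp only [norm_smul, Complex.norm_cpow_eq_rpow_re_of_pos (mul_pos hp hx),
      Complex.norm_cpow_eq_rpow_re_of_pos hx, Complex.sub_re, Complex.one_re,
      Real.mul_rpow hp.le (le_of_lt hx), mul_assoc]
  rw [hpull, Real.rpow_sub_one hp.ne', div_eq_inv_mul, mul_assoc] at hscale
  rw [Real.rpow_neg hp.le, eq_inv_mul_iff_mul_eq₀ (by positivity)]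
  exact mul_left_cancel₀ (inv_ne_zero hp.ne') hscale

lemma hasSum_mellin_smul_comp_mul_left {ι : Type*} [Countable ι] {c : ι → ℂ} {p : ι → ℝ}
    (hg : MellinConvergent g w) (hp : ∀ i, c i ≠ 0 → 0 < p i)
    (hsum : Summable fun i ↦ ‖c i‖ * p i ^ (-w.re)) :
    HasSum (fun i ↦ c i • (p i : ℂ) ^ (-w) • mellin g w)
      (mellin (fun x ↦ ∑' i, c i • g (p i * x)) w) := by
  set F : ι → ℝ → E := fun i x ↦ c i • (x : ℂ) ^ (w - 1) • g (p i * x)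
  have hF_int (i : ι) : IntegrableOn (F i) (Ioi 0) := by
    rcases eq_or_ne (c i) 0 with hi | hi
    · simp [F, hi]
    · exact ((MellinConvergent.comp_mul_left (hp i hi)).2 hg).smul (c i)
  have hF_norm (i : ι) : ∫ x in Ioi (0 : ℝ), ‖F i x‖ =
      ‖c i‖ * p i ^ (-w.re) * ∫ x in Ioi (0 : ℝ), ‖(x : ℂ) ^ (w - 1) • g x‖ := by
    simp only [F, norm_smul (c i), integral_const_mul]
    rcases eq_or_ne (c i) 0 with hi | hi
    · simp [hi]
    · rw [integral_norm_cpow_smul_comp_mul_left g w (hp i hi), mul_assoc]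
  have hF_val (i : ι) : ∫ x in Ioi (0 : ℝ), F i x = c i • (p i : ℂ) ^ (-w) • mellin g w := by
    simp only [F, integral_smul]
    rcases eq_or_ne (c i) 0 with hi | hi
    · simp [hi]
    · rw [← mellin_comp_mul_left g w (hp i hi), mellin]
  have hF_tsum : ∫ x in Ioi (0 : ℝ), ∑' i, F i x = mellin (fun x ↦ ∑' i, c i • g (p i * x)) w := by
    simp only [F, mellin, smul_comm (c _), tsum_const_smul'']
  rw [← hF_tsum]
  simp only [← hF_val]
  refine hasSum_integral_of_summable_integral_norm hF_int ?_
  simpa only [hF_norm] using hsum.mul_right _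

end Scaling

lemma mellin_moebiusExpSum {s : ℂ} (h1 : 1 < s.re) (h2 : s.re < 2) :
    mellin moebiusExpSum (-s) = Complex.Gamma (-s) / riemannZeta s := by
  have hlo : -2 < (-s).re := by rw [Complex.neg_re]; linarith
  have hhi : (-s).re < -1 := by rw [Complex.neg_re]; linarith
  have hsum : Summable fun m : ℕ ↦ ‖(μ m : ℂ)‖ * ((m : ℝ)⁻¹) ^ (-(-s).re) := by
    refine .of_nonneg_of_le (fun m ↦ by positivity) (fun m ↦ ?_)
      (Real.summable_one_div_nat_rpow.2 h1)
    rw [Complex.neg_re, neg_neg, Real.inv_rpow (Nat.cast_nonneg m), one_div]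
    exact mul_le_of_le_one_left (by positivity) (norm_moebius_le m)
  have hterms := hasSum_mellin_smul_comp_mul_left (mellinConvergent_expRem hlo hhi)
    (fun m hm ↦ inv_pos.2 (Nat.cast_pos.2 (Nat.pos_of_ne_zero fun h0 ↦ hm (by simp [h0])))) hsum
  have hF : moebiusExpSum = fun x ↦ ∑' m : ℕ, (μ m : ℂ) • (expRem ((m : ℝ)⁻¹ * x) : ℂ) := by
    ext x
    simp only [moebiusExpSum, smul_eq_mul, div_eq_inv_mul]
  have hterm (m : ℕ) : (μ m : ℂ) • (((m : ℝ)⁻¹ : ℝ) : ℂ) ^ (-(-s)) • Complex.Gamma (-s) =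
      (μ m : ℂ) * (m : ℂ) ^ (-s) * Complex.Gamma (-s) := by
    rw [smul_eq_mul, smul_eq_mul, ← mul_assoc, Complex.ofReal_inv, Complex.ofReal_natCast,
      Complex.inv_cpow _ _ (by simp [Complex.natCast_arg, Real.pi_ne_zero.symm]), neg_neg,
      Complex.cpow_neg]
  simp only [mellin_expRem hlo hhi, hterm] at hterms
  rw [hF, hterms.unique ((hasSum_moebius_mul_cpow h1).mul_right _), one_div_mul_eq_div]

/-- The function `Γ(-s) / ζ(s)`, to which `s ↦ mellin moebiusExpSum (-s)` continues. It is written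
with `Γ(2 - s)` and `riemannZeta₁ s = (s - 1) ζ(s)` so that the formula is also right at the
removable singularity `s = 1`. -/
noncomputable def moebiusExpMellin (s : ℂ) : ℂ := Complex.Gamma (2 - s) / (s * riemannZeta₁ s)

lemma riemannZeta₁_eq {s : ℂ} (hs : s ≠ 1) : riemannZeta₁ s = (s - 1) * riemannZeta s := by
  rw [riemannZeta_eq_inv_sub_mul hs, mul_inv_cancel_left₀ (sub_ne_zero.2 hs)]

lemma mellin_moebiusExpSum_eq_moebiusExpMellin {s : ℂ} (h1 : 1 < s.re) (h2 : s.re < 2) :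
    mellin moebiusExpSum (-s) = moebiusExpMellin s := by
  have hs0 : s ≠ 0 := by rintro rfl; norm_num at h1
  have hs1 : s ≠ 1 := by rintro rfl; simp at h1
  have hG1 := Complex.Gamma_add_one (-s) (neg_ne_zero.2 hs0)
  have hG2 := Complex.Gamma_add_one (-s + 1) (by rwa [neg_add_eq_sub, sub_ne_zero, ne_comm])
  rw [mellin_moebiusExpSum h1 h2, moebiusExpMellin, riemannZeta₁_eq hs1,
    show 2 - s = -s + 1 + 1 by ring, hG2, hG1]
  have := sub_ne_zero.2 hs1
  have := riemannZeta_ne_zero_of_one_lt_re h1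
  field_simp
  ring

lemma moebiusExpSum_isBigO_rpow {l : Filter ℝ} (hl : ∀ᶠ x in l, 0 < x) {a : ℝ} (h1 : 1 < a)
    (h2 : a ≤ 2) : moebiusExpSum =O[l] fun x ↦ x ^ a :=
  isBigO_rpow_of_le hl fun x hx ↦ by
    rw [mul_comm]
    exact norm_moebiusExpSum_le hx.le h1 h2

lemma differentiableAt_Gamma_two_sub {s : ℂ} (hs : s.re < 2) :
    DifferentiableAt ℂ (fun z ↦ Complex.Gamma (2 - z)) s := by
  have hpos : 0 < (2 - s).re := by simpa using hs
  have hne (m : ℕ) : 2 - s ≠ -m := fun h ↦ by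
    rw [h] at hpos
    simp at hpos
    linarith [m.cast_nonneg (α := ℝ)]
  exact (Complex.differentiableAt_Gamma _ hne).comp s (by fun_prop)

lemma differentiableAt_mellin_moebiusExpSum_neg {a : ℝ} {s : ℂ}
    (hF : moebiusExpSum =O[atTop] fun x ↦ x ^ a) (h1 : a < s.re) (h2 : s.re < 2) :
    DifferentiableAt ℂ (fun z ↦ mellin moebiusExpSum (-z)) s := by
  have hzero : moebiusExpSum =O[𝓝[>] 0] fun x : ℝ ↦ x ^ (-(-2 : ℝ)) := by
    rw [neg_neg]
    exact moebiusExpSum_isBigO_rpow self_mem_nhdsWithin one_lt_two le_rfl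
  have hmellin : DifferentiableAt ℂ (mellin moebiusExpSum) (-s) :=
    mellin_differentiableAt_of_isBigO_rpow (a := -a) (b := -2) locallyIntegrableOn_moebiusExpSum
      (by simpa using hF) (by simpa using h1) hzero (by simpa using h2)
  exact hmellin.comp s (by fun_prop)

lemma mellin_moebiusExpSum_mul_eq_Gamma {a : ℝ} {s : ℂ}
    (hF : moebiusExpSum =O[atTop] fun x ↦ x ^ a) (h1 : a < s.re) (h2 : s.re < 2) :
    mellin moebiusExpSum (-s) * (s * riemannZeta₁ s) = Complex.Gamma (2 - s) := by
  set U : Set ℂ := {z | a < z.re ∧ z.re < 2}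
  have hUo : IsOpen U := (isOpen_lt continuous_const Complex.continuous_re).inter
    (isOpen_lt Complex.continuous_re continuous_const)
  have hUc : IsPreconnected U :=
    ((convex_halfSpace_re_gt a).inter (convex_halfSpace_re_lt 2)).isPreconnected
  have hleft : DifferentiableOn ℂ (fun z ↦ mellin moebiusExpSum (-z) * (z * riemannZeta₁ z)) U :=
    fun z hz ↦ ((differentiableAt_mellin_moebiusExpSum_neg hF hz.1 hz.2).mul
      (by fun_prop)).differentiableWithinAt
  have hright : DifferentiableOn ℂ (fun z ↦ Complex.Gamma (2 - z)) U :=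
    fun z hz ↦ (differentiableAt_Gamma_two_sub hz.2).differentiableWithinAt
  have heq {z : ℂ} (hz1 : 1 < z.re) (hz2 : z.re < 2) :
      mellin moebiusExpSum (-z) * (z * riemannZeta₁ z) = Complex.Gamma (2 - z) := by
    have hz : z ≠ 1 := by rintro rfl; simp at hz1
    have hz0 : z ≠ 0 := by rintro rfl; norm_num at hz1
    rw [mellin_moebiusExpSum_eq_moebiusExpMellin hz1 hz2, moebiusExpMellin, div_mul_cancel₀]
    rw [riemannZeta₁_eq hz]
    exact mul_ne_zero hz0 (mul_ne_zero (sub_ne_zero.2 hz) (riemannZeta_ne_zero_of_one_lt_re hz1))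
  obtain ⟨c, hc, hc2⟩ := exists_between (max_lt (h1.trans h2) one_lt_two)
  obtain ⟨hac, h1c⟩ := max_lt_iff.1 hc
  refine (hleft.analyticOnNhd hUo).eqOn_of_preconnected_of_eventuallyEq (hright.analyticOnNhd hUo)
    hUc (z₀ := c) ⟨hac, hc2⟩ ?_ ⟨h1, h2⟩
  have hre : Tendsto Complex.re (𝓝 (c : ℂ)) (𝓝 c) :=
    Complex.continuous_re.tendsto' _ _ (Complex.ofReal_re c)
  filter_upwards [hre.eventually (lt_mem_nhds h1c), hre.eventually (gt_mem_nhds hc2)] with z hz1 hz2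
  exact heq hz1 hz2

lemma riemannZeta_ne_zero_of_moebiusExpSum_isBigO {a : ℝ} {s : ℂ}
    (hF : moebiusExpSum =O[atTop] fun x ↦ x ^ a) (h1 : a < s.re) (hs : s ≠ 1) :
    riemannZeta s ≠ 0 := by
  rcases le_or_gt 1 s.re with h | h
  · exact riemannZeta_ne_zero_of_one_le_re h
  · intro hzero
    have hGamma := mellin_moebiusExpSum_mul_eq_Gamma hF h1 (by linarith)
    rw [riemannZeta₁_eq hs, hzero, mul_zero, mul_zero, mul_zero] at hGamma
    exact Complex.Gamma_ne_zero_of_re_pos (by simpa using by linarith) hGamma.symm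

/-! ### Growth of `ζ` in the half-plane `Re s > 0` -/

/-- The fractional part on `(1, ∞)`, extended by zero, whose Mellin transform continues `ζ` to the
half-plane `Re s > 0`. -/
noncomputable def fractTail : ℝ → ℂ := indicator (Ioi 1) fun t ↦ ((Int.fract t : ℝ) : ℂ)

lemma norm_ofReal_fract_le (t : ℝ) : ‖((Int.fract t : ℝ) : ℂ)‖ ≤ 1 := by
  rw [Complex.norm_real, Real.norm_of_nonneg (Int.fract_nonneg t)]
  exact (Int.fract_lt_one t).le

lemma measurable_ofReal_fract : Measurable fun t : ℝ ↦ ((Int.fract t : ℝ) : ℂ) :=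
  Complex.measurable_ofReal.comp measurable_fract

lemma norm_fractTail_le (t : ℝ) : ‖fractTail t‖ ≤ 1 :=
  (norm_indicator_le_norm_self _ _).trans (norm_ofReal_fract_le t)

lemma fractTail_isBigO_zero (b : ℝ) : fractTail =O[𝓝[>] 0] fun t : ℝ ↦ t ^ b := by
  refine IsBigO.of_bound 0 ?_
  filter_upwards [mem_nhdsWithin_of_mem_nhds (Iio_mem_nhds one_pos)] with t ht
  rw [fractTail, indicator_of_notMem (notMem_Ioi.2 (le_of_lt ht)), norm_zero, zero_mul]

lemma fractTail_isBigO_atTop : fractTail =O[atTop] fun t : ℝ ↦ t ^ (-(0 : ℝ)) :=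
  IsBigO.of_bound 1 (Eventually.of_forall fun t ↦ by simpa using norm_fractTail_le t)

lemma locallyIntegrableOn_fractTail : LocallyIntegrableOn fractTail (Ioi 0) :=
  ((locallyIntegrable_const (1 : ℝ)).mono
    (measurable_ofReal_fract.indicator measurableSet_Ioi).aestronglyMeasurable
    (Eventually.of_forall fun t ↦
      (norm_fractTail_le t).trans_eq norm_one.symm)).locallyIntegrableOn _

lemma differentiableAt_mellin_fractTail_neg {s : ℂ} (hs : 0 < s.re) :
    DifferentiableAt ℂ (fun z ↦ mellin fractTail (-z)) s := by
  have hmellin : DifferentiableAt ℂ (mellin fractTail) (-s) :=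
    mellin_differentiableAt_of_isBigO_rpow (b := -s.re - 1) locallyIntegrableOn_fractTail
      fractTail_isBigO_atTop (by simpa using hs) (fractTail_isBigO_zero _) (by simp)
  exact hmellin.comp s (by fun_prop)

lemma mellin_fractTail_eq_integral (w : ℂ) :
    mellin fractTail w = ∫ t in Ioi (1 : ℝ), (t : ℂ) ^ (w - 1) * ((Int.fract t : ℝ) : ℂ) := by
  have hindicator : (fun t : ℝ ↦ (t : ℂ) ^ (w - 1) • fractTail t) =
      indicator (Ioi 1) fun t : ℝ ↦ (t : ℂ) ^ (w - 1) * ((Int.fract t : ℝ) : ℂ) := by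
    ext t
    by_cases ht : t ∈ Ioi 1 <;> simp [fractTail, ht]
  rw [mellin, hindicator, setIntegral_indicator measurableSet_Ioi,
    inter_eq_self_of_subset_right (Ioi_subset_Ioi zero_le_one)]

lemma norm_mellin_fractTail_neg_le {s : ℂ} (hs : 0 < s.re) :
    ‖mellin fractTail (-s)‖ ≤ 1 / s.re := by
  have hlt : -s.re - 1 < -1 := by linarith
  have hval : ∫ t in Ioi (1 : ℝ), t ^ (-s.re - 1) = 1 / s.re := by
    rw [integral_Ioi_rpow_of_lt hlt one_pos, Real.one_rpow, sub_add_cancel, neg_div_neg_eq]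
  rw [mellin_fractTail_eq_integral, ← hval]
  refine norm_integral_le_of_norm_le (integrableOn_Ioi_rpow_of_lt hlt one_pos) ?_
  refine (ae_restrict_iff' measurableSet_Ioi).2 (Eventually.of_forall fun t ht ↦ ?_)
  have ht0 : 0 < t := zero_lt_one.trans ht
  rw [norm_mul, Complex.norm_cpow_eq_rpow_re_of_pos ht0, Complex.sub_re, Complex.neg_re,
    Complex.one_re]
  exact mul_le_of_le_one_right (by positivity) (norm_ofReal_fract_le t)

lemma riemannZeta_eq_mul_integral_floor {s : ℂ} (hs : 1 < s.re) :
    riemannZeta s = s * ∫ t in Ioi (1 : ℝ), (⌊t⌋₊ : ℂ) * (t : ℂ) ^ (-(s + 1)) := by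
  have hsum : (fun n : ℕ ↦ ∑ k ∈ Finset.Icc 1 n, (1 : ℕ → ℝ) k) =O[atTop]
      fun n ↦ (n : ℝ) ^ (1 : ℝ) := by
    simpa using isBigO_refl _ _
  have habel := LSeries_eq_mul_integral_of_nonneg 1 zero_le_one hs hsum fun _ ↦ zero_le_one
  rw [← LSeries_one_eq_riemannZeta hs]
  simpa [Pi.one_def] using habel

lemma integral_floor_mul_cpow {s : ℂ} (hs : 1 < s.re) :
    ∫ t in Ioi (1 : ℝ), (⌊t⌋₊ : ℂ) * (t : ℂ) ^ (-(s + 1)) =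
      1 / (s - 1) - mellin fractTail (-s) := by
  have hmain : ∫ t in Ioi (1 : ℝ), (t : ℂ) ^ (-s) = 1 / (s - 1) := by
    rw [integral_Ioi_cpow_of_lt (by simpa using hs) one_pos, Complex.ofReal_one, Complex.one_cpow,
      show -s + 1 = -(s - 1) by ring, neg_div_neg_eq]
  have hmain_int : IntegrableOn (fun t : ℝ ↦ (t : ℂ) ^ (-s)) (Ioi 1) :=
    integrableOn_Ioi_cpow_of_lt (by simpa using hs) one_pos
  have hfract_int :
      IntegrableOn (fun t : ℝ ↦ (t : ℂ) ^ (-s - 1) * ((Int.fract t : ℝ) : ℂ)) (Ioi 1) :=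
    (integrableOn_Ioi_cpow_of_lt (by simpa using by linarith) one_pos).mul_bdd
      measurable_ofReal_fract.aestronglyMeasurable (Eventually.of_forall norm_ofReal_fract_le)
  rw [← hmain, mellin_fractTail_eq_integral, ← integral_sub hmain_int hfract_int]
  refine setIntegral_congr_fun measurableSet_Ioi fun t ht ↦ ?_
  have ht0 : 0 < t := zero_lt_one.trans ht
  have hfloor : (⌊t⌋₊ : ℂ) = t - ((Int.fract t : ℝ) : ℂ) := by
    rw [← Complex.ofReal_sub, Int.self_sub_fract, ← natCast_floor_eq_intCast_floor ht0.le,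
      Complex.ofReal_natCast]
  have hcpow : (t : ℂ) ^ (-s) = (t : ℂ) ^ (-s - 1) * t := by
    have htc := Complex.ofReal_ne_zero.2 ht0.ne'
    rw [Complex.cpow_sub _ _ htc, Complex.cpow_one, div_mul_cancel₀ _ htc]
  simp only [hfloor, hcpow, neg_add']
  ring

lemma riemannZeta₁_eq_of_one_lt_re {s : ℂ} (hs : 1 < s.re) :
    riemannZeta₁ s = s - s * (s - 1) * mellin fractTail (-s) := by
  have hs1 : s ≠ 1 := by rintro rfl; simp at hs
  rw [riemannZeta₁_eq hs1, riemannZeta_eq_mul_integral_floor hs, integral_floor_mul_cpow hs]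
  field_simp [sub_ne_zero.2 hs1]

lemma riemannZeta₁_eq_of_re_pos {s : ℂ} (hs : 0 < s.re) :
    riemannZeta₁ s = s - s * (s - 1) * mellin fractTail (-s) := by
  set U : Set ℂ := {z | 0 < z.re}
  have hUo : IsOpen U := isOpen_lt continuous_const Complex.continuous_re
  have hUc : IsPreconnected U := (convex_halfSpace_re_gt _).isPreconnected
  have hright : DifferentiableOn ℂ (fun z ↦ z - z * (z - 1) * mellin fractTail (-z)) U := by
    intro z hz
    have := differentiableAt_mellin_fractTail_neg hz
    exact DifferentiableAt.differentiableWithinAt (by fun_prop)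
  refine (differentiable_riemannZeta₁.differentiableOn.analyticOnNhd
    hUo).eqOn_of_preconnected_of_eventuallyEq (hright.analyticOnNhd hUo) hUc (z₀ := 2)
    (by simp [U]) ?_ hs
  filter_upwards [Complex.continuous_re.continuousAt.eventually
    (lt_mem_nhds (show 1 < (2 : ℂ).re by simp))] with z hz
  exact riemannZeta₁_eq_of_one_lt_re hz

lemma norm_riemannZeta₁_le {s : ℂ} (hs : 0 < s.re) :
    ‖riemannZeta₁ s‖ ≤ ‖s‖ + ‖s‖ * ‖s - 1‖ / s.re := by
  rw [riemannZeta₁_eq_of_re_pos hs]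
  refine (norm_sub_le _ _).trans ?_
  rw [norm_mul, norm_mul, ← mul_one_div (‖s‖ * ‖s - 1‖)]
  gcongr
  exact norm_mellin_fractTail_neg_le hs

lemma sub_lt_re_of_mem_ball {c z : ℂ} {R : ℝ} (hz : z ∈ Metric.ball c R) : c.re - R < z.re := by
  have hre := (Complex.abs_re_le_norm (z - c)).trans_lt (mem_ball_iff_norm.1 hz)
  rw [Complex.sub_re] at hre
  linarith [neg_abs_le (z.re - c.re)]

lemma norm_riemannZeta₁_le_of_mem_ball {a : ℝ} {c z : ℂ} (h0 : 0 < a) (h1 : a ≤ 1) (hc : c.re = 2)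
    (hz : z ∈ Metric.ball c (2 - a)) : ‖riemannZeta₁ z‖ ≤ 32 / a * (1 + |c.im|) ^ 2 := by
  have hre : a < z.re := by linarith [sub_lt_re_of_mem_ball hz]
  have hdist : ‖z - c‖ < 2 := by linarith [mem_ball_iff_norm.1 hz]
  have him := abs_nonneg c.im
  have hnorm_c : ‖c‖ ≤ 2 + |c.im| := by simpa [hc] using Complex.norm_le_abs_re_add_abs_im c
  have hnorm : ‖z‖ ≤ 4 * (1 + |c.im|) := by linarith [norm_le_norm_sub_add z c]
  have hnorm_sub : ‖z - 1‖ ≤ 4 * (1 + |c.im|) := by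
    have hnorm_c_sub : ‖c - 1‖ ≤ 1 + |c.im| := by
      simpa [hc, show (2 : ℝ) - 1 = 1 by norm_num] using
        Complex.norm_le_abs_re_add_abs_im (c - 1)
    linarith [norm_sub_le_norm_sub_add_norm_sub z c 1]
  calc ‖riemannZeta₁ z‖ ≤ ‖z‖ + ‖z‖ * ‖z - 1‖ / z.re := norm_riemannZeta₁_le (h0.trans hre)
    _ ≤ 16 * (1 + |c.im|) ^ 2 / a + 4 * (1 + |c.im|) * (4 * (1 + |c.im|)) / a := by
        gcongr
        refine hnorm.trans ((le_div_iff₀ h0).2 ?_)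
        nlinarith
    _ = 32 / a * (1 + |c.im|) ^ 2 := by ring

lemma one_le_two_mul_norm_riemannZeta₁ {s : ℂ} (hs : s.re = 2) : 1 ≤ 2 * ‖riemannZeta₁ s‖ := by
  have hs1 : s ≠ 1 := by rintro rfl; norm_num at hs
  have hre : 1 < s.re := by linarith
  have hsub : 1 ≤ ‖s - 1‖ := by
    have := Complex.re_le_norm (s - 1)
    rw [Complex.sub_re, hs, Complex.one_re] at this
    linarith
  have hsum : ∑' m : ℕ, 1 / (m : ℝ) ^ s.re ≤ 2 := by
    simp only [hs, Real.rpow_two, hasSum_zeta_two.tsum_eq]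
    nlinarith [Real.pi_lt_d2, Real.pi_pos]
  have hzeta := (norm_one_div_riemannZeta_le hre).trans hsum
  rw [norm_div, norm_one, div_le_iff₀ (norm_pos_iff.2 (riemannZeta_ne_zero_of_one_lt_re hre))]
    at hzeta
  rw [riemannZeta₁_eq hs1, norm_mul, mul_left_comm]
  exact one_le_mul_of_one_le_of_one_le hsub hzeta

/-! ### Lower bounds in zero-free half-planes -/

lemma exists_eq_mul_exp_of_ne_zero_on_ball {f : ℂ → ℂ} {c : ℂ} {R : ℝ} (hR : 0 < R)
    (hf : DifferentiableOn ℂ f (Metric.ball c R)) (h0 : ∀ z ∈ Metric.ball c R, f z ≠ 0) :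
    ∃ g : ℂ → ℂ, DifferentiableOn ℂ g (Metric.ball c R) ∧ g c = 0 ∧
      ∀ z ∈ Metric.ball c R, f z = f c * Complex.exp (g z) := by
  obtain ⟨g, hgc, hg⟩ :=
    ((hf.deriv Metric.isOpen_ball).div hf h0).isExactOn_ball.with_val_at c 0
  refine ⟨g, fun z hz ↦ (hg z hz).differentiableAt.differentiableWithinAt, hgc, fun z hz ↦ ?_⟩
  have hder {w : ℂ} (hw : w ∈ Metric.ball c R) :
      HasDerivAt (fun w ↦ f w * Complex.exp (-g w)) 0 w := by
    have hfw := (hf.differentiableAt (Metric.isOpen_ball.mem_nhds hw)).hasDerivAt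
    refine (hfw.mul (hg w hw).neg.cexp).congr_deriv ?_
    have := h0 w hw
    simp only [Pi.div_apply]
    field_simp
    ring
  have hconst := Metric.isOpen_ball.is_const_of_deriv_eq_zero (convex_ball c R).isPreconnected
    (fun w hw ↦ (hder hw).differentiableAt.differentiableWithinAt)
    (fun w hw ↦ (hder hw).deriv) hz (Metric.mem_ball_self hR)
  simp only [hgc, neg_zero, Complex.exp_zero, mul_one] at hconst
  rw [← hconst, mul_assoc, ← Complex.exp_add, neg_add_cancel, Complex.exp_zero, mul_one]

lemma norm_le_rpow_mul_norm_of_ne_zero_on_ball {f : ℂ → ℂ} {c z : ℂ} {R M : ℝ} (hR : 0 < R)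
    (hM : 1 < M) (hf : DifferentiableOn ℂ f (Metric.ball c R))
    (h0 : ∀ w ∈ Metric.ball c R, f w ≠ 0) (hfM : ∀ w ∈ Metric.ball c R, ‖f w‖ ≤ ‖f c‖ * M)
    (hz : z ∈ Metric.ball c R) :
    ‖f c‖ ≤ M ^ (2 * ‖z - c‖ / (R - ‖z - c‖)) * ‖f z‖ := by
  obtain ⟨g, hg, hgc, hfg⟩ := exists_eq_mul_exp_of_ne_zero_on_ball hR hf h0
  have hM0 : 0 < M := zero_lt_one.trans hM
  have hfc : 0 < ‖f c‖ := norm_pos_iff.2 (h0 c (Metric.mem_ball_self hR))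
  have hmaps : MapsTo (· + c) (Metric.ball (0 : ℂ) R) (Metric.ball c R) := fun w hw ↦ by
    simpa using hw
  have hre (w : ℂ) (hw : w ∈ Metric.ball (0 : ℂ) R) : (g (w + c)).re ≤ Real.log M := by
    have hw' := hfM _ (hmaps hw)
    rw [hfg _ (hmaps hw), norm_mul, Complex.norm_exp] at hw'
    exact (Real.le_log_iff_exp_le hM0).2 (le_of_mul_le_mul_left hw' hfc)
  have hg_le := Complex.borelCaratheodory_zero (f := fun w ↦ g (w + c)) (z := z - c)
    (Real.log_pos hM) (hg.comp (by fun_prop) hmaps) hre hR (by simpa [dist_eq_norm] using hz)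
    (by simpa using hgc)
  rw [sub_add_cancel] at hg_le
  have hexp : 1 ≤ M ^ (2 * ‖z - c‖ / (R - ‖z - c‖)) * Real.exp (g z).re := by
    rw [Real.rpow_def_of_pos hM0, ← Real.exp_add, Real.one_le_exp_iff, mul_div_assoc',
      mul_left_comm, ← mul_assoc]
    linarith [neg_abs_le (g z).re, Complex.abs_re_le_norm (g z)]
  rw [hfg z hz, norm_mul, Complex.norm_exp, mul_left_comm]
  exact le_mul_of_one_le_right hfc.le hexp

lemma zetaZeroFreeRightOf_one : ZetaZeroFreeRightOf 1 :=
  fun _ hs _ ↦ riemannZeta_ne_zero_of_one_le_re hs.le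

lemma ZetaZeroFreeRightOf.mono {a b : ℝ} (h : ZetaZeroFreeRightOf a) (hab : a ≤ b) :
    ZetaZeroFreeRightOf b :=
  fun s hs ↦ h s (hab.trans_lt hs)

lemma ZetaZeroFreeRightOf.riemannZeta₁_ne_zero {a : ℝ} {s : ℂ} (h : ZetaZeroFreeRightOf a)
    (hs : a < s.re) : riemannZeta₁ s ≠ 0 := by
  rcases eq_or_ne s 1 with rfl | h1
  · simp
  · rw [riemannZeta₁_eq h1]
    exact mul_ne_zero (sub_ne_zero.2 h1) (h s hs h1)

lemma ZetaZeroFreeRightOf.one_le_rpow_mul_norm_riemannZeta₁ {a : ℝ} {s : ℂ}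
    (h : ZetaZeroFreeRightOf a) (h0 : 0 < a) (h1 : a ≤ 1) (has : a < s.re) (hs : s.re ≤ 2) :
    1 ≤ 2 * ((64 / a * (1 + |s.im|) ^ 2) ^ (2 * (2 - s.re) / (s.re - a)) * ‖riemannZeta₁ s‖) := by
  set c : ℂ := 2 + s.im * Complex.I with hc
  have hcre : c.re = 2 := by simp [hc]
  have hcim : c.im = s.im := by simp [hc]
  have hdist : ‖s - c‖ = 2 - s.re := by
    have hsub : s - c = ((s.re - 2 : ℝ) : ℂ) := by apply Complex.ext <;> simp [hcre, hcim]
    rw [hsub, Complex.norm_real, Real.norm_of_nonpos (by linarith), neg_sub]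
  have hcenter := one_le_two_mul_norm_riemannZeta₁ hcre
  have hM : 1 < 64 / a * (1 + |s.im|) ^ 2 :=
    one_lt_mul_of_lt_of_le ((one_lt_div h0).2 (by linarith))
      (one_le_pow₀ (by linarith [abs_nonneg s.im]))
  have hbound (z : ℂ) (hz : z ∈ Metric.ball c (2 - a)) :
      ‖riemannZeta₁ z‖ ≤ ‖riemannZeta₁ c‖ * (64 / a * (1 + |s.im|) ^ 2) :=
    calc ‖riemannZeta₁ z‖ ≤ 32 / a * (1 + |s.im|) ^ 2 * 1 := by
          rw [mul_one, ← hcim]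
          exact norm_riemannZeta₁_le_of_mem_ball h0 h1 hcre hz
      _ ≤ 32 / a * (1 + |s.im|) ^ 2 * (2 * ‖riemannZeta₁ c‖) := by gcongr
      _ = ‖riemannZeta₁ c‖ * (64 / a * (1 + |s.im|) ^ 2) := by ring
  have hlow := norm_le_rpow_mul_norm_of_ne_zero_on_ball (z := s) (by linarith) hM
    differentiable_riemannZeta₁.differentiableOn
    (fun z hz ↦ h.riemannZeta₁_ne_zero (by linarith [sub_lt_re_of_mem_ball hz])) hbound
    (by rw [mem_ball_iff_norm, hdist]; linarith)
  rw [hdist, sub_sub_sub_cancel_left] at hlow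
  linarith

lemma ZetaZeroFreeRightOf.exists_one_le_mul_norm_riemannZeta₁ {a b : ℝ}
    (h : ZetaZeroFreeRightOf a) (h0 : 0 < a) (h1 : a ≤ 1) (hab : a < b) :
    ∃ C : ℝ, 0 < C ∧ ∃ A : ℕ, ∀ s : ℂ, b ≤ s.re → s.re ≤ 2 →
      1 ≤ C * (1 + |s.im|) ^ A * ‖riemannZeta₁ s‖ := by
  obtain ⟨A, hA⟩ := exists_nat_ge (2 * 2 / (b - a))
  refine ⟨2 * (64 / a) ^ A, by positivity, 2 * A, fun s hbs hs ↦ ?_⟩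
  have hM : 1 ≤ 64 / a * (1 + |s.im|) ^ 2 :=
    one_le_mul_of_one_le_of_one_le ((one_le_div h0).2 (by linarith))
      (one_le_pow₀ (by linarith [abs_nonneg s.im]))
  have hexponent : 2 * (2 - s.re) / (s.re - a) ≤ A :=
    (div_le_div₀ (by norm_num) (by linarith) (by linarith) (by linarith)).trans hA
  calc 1 ≤ 2 * ((64 / a * (1 + |s.im|) ^ 2) ^ (2 * (2 - s.re) / (s.re - a)) *
          ‖riemannZeta₁ s‖) :=
        h.one_le_rpow_mul_norm_riemannZeta₁ h0 h1 (hab.trans_le hbs) hs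
    _ ≤ 2 * ((64 / a * (1 + |s.im|) ^ 2) ^ (A : ℝ) * ‖riemannZeta₁ s‖) := by gcongr
    _ = 2 * (64 / a) ^ A * (1 + |s.im|) ^ (2 * A) * ‖riemannZeta₁ s‖ := by
        rw [Real.rpow_natCast, mul_pow, ← pow_mul]
        ring

lemma norm_Gamma_le {z : ℂ} (hz : 0 < z.re) : ‖Complex.Gamma z‖ ≤ Real.Gamma z.re := by
  rw [Complex.Gamma_eq_integral hz, Complex.GammaIntegral, Real.Gamma_eq_integral hz]
  refine (norm_integral_le_integral_norm _).trans_eq ?_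
  refine setIntegral_congr_fun measurableSet_Ioi fun t ht ↦ ?_
  rw [norm_mul, Complex.norm_cpow_eq_rpow_re_of_pos ht, Complex.norm_real,
    Real.norm_of_nonneg (Real.exp_pos _).le, Complex.sub_re, Complex.one_re]

lemma exists_norm_Gamma_mul_pow_le {a : ℝ} (b : ℝ) (ha : 0 < a) (N : ℕ) :
    ∃ C : ℝ, ∀ z : ℂ, a ≤ z.re → z.re ≤ b → ‖Complex.Gamma z‖ * (1 + |z.im|) ^ N ≤ C := by
  induction N generalizing a b with
  | zero =>
    have hcont : ContinuousOn Real.Gamma (Icc a b) := fun x hx ↦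
      (Real.differentiableAt_Gamma fun m ↦ by
        linarith [hx.1, m.cast_nonneg (α := ℝ)]).continuousAt.continuousWithinAt
    obtain ⟨C, hC⟩ := (isCompact_Icc.image_of_continuousOn hcont).bddAbove
    refine ⟨C, fun z h1 h2 ↦ ?_⟩
    rw [pow_zero, mul_one]
    exact (norm_Gamma_le (ha.trans_le h1)).trans (hC ⟨z.re, ⟨h1, h2⟩, rfl⟩)
  | succ N ih =>
    obtain ⟨C, hC⟩ := ih (b + 1) (show 0 < a + 1 by linarith)
    refine ⟨C * (1 / a + 1), fun z h1 h2 ↦ ?_⟩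
    have hz : z ≠ 0 := by rintro rfl; exact ha.not_ge h1
    have hshift := hC (z + 1) (by simpa using h1) (by simpa using h2)
    rw [Complex.Gamma_add_one z hz, norm_mul, Complex.add_im, Complex.one_im, add_zero] at hshift
    have him : 1 + |z.im| ≤ ‖z‖ * (1 / a + 1) := by
      have : 1 ≤ ‖z‖ * (1 / a) := by
        rw [mul_one_div]
        exact (one_le_div ha).2 (h1.trans (Complex.re_le_norm z))
      linarith [Complex.abs_im_le_norm z]
    calc ‖Complex.Gamma z‖ * (1 + |z.im|) ^ (N + 1)
        = ‖Complex.Gamma z‖ * (1 + |z.im|) ^ N * (1 + |z.im|) := by ring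
      _ ≤ ‖Complex.Gamma z‖ * (1 + |z.im|) ^ N * (‖z‖ * (1 / a + 1)) := by gcongr
      _ = ‖z‖ * ‖Complex.Gamma z‖ * (1 + |z.im|) ^ N * (1 / a + 1) := by ring
      _ ≤ C * (1 / a + 1) := by gcongr

lemma ZetaZeroFreeRightOf.differentiableAt_moebiusExpMellin {a : ℝ} {s : ℂ}
    (h : ZetaZeroFreeRightOf a) (h0 : 0 ≤ a) (h1 : a < s.re) (h2 : s.re < 2) :
    DifferentiableAt ℂ moebiusExpMellin s := by
  have hs0 : s ≠ 0 := by rintro rfl; exact h0.not_gt h1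
  exact (differentiableAt_Gamma_two_sub h2).div (by fun_prop)
    (mul_ne_zero hs0 (h.riemannZeta₁_ne_zero h1))

lemma ZetaZeroFreeRightOf.exists_norm_moebiusExpMellin_le {a b c : ℝ}
    (h : ZetaZeroFreeRightOf a) (h0 : 0 < a) (h1 : a ≤ 1) (hab : a < b) (hc : c < 2) :
    ∃ C : ℝ, ∀ s : ℂ, b ≤ s.re → s.re ≤ c → ‖moebiusExpMellin s‖ ≤ C * (1 + s.im ^ 2)⁻¹ := by
  obtain ⟨C, hC0, A, hC⟩ := h.exists_one_le_mul_norm_riemannZeta₁ h0 h1 hab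
  obtain ⟨B, hB⟩ := exists_norm_Gamma_mul_pow_le 2 (sub_pos.2 hc) (A + 2)
  refine ⟨B * (C / a), fun s hbs hsc ↦ ?_⟩
  have hζ_low := hC s hbs (by linarith)
  have hΓ := hB (2 - s) (sub_le_sub_left hsc 2) (by simpa using by linarith)
  rw [Complex.sub_im, Complex.im_ofNat, zero_sub, abs_neg] at hΓ
  have hs : a ≤ ‖s‖ := by linarith [Complex.re_le_norm s]
  have hs0 : 0 < ‖s‖ := h0.trans_le hs
  have hζ0 : 0 < ‖riemannZeta₁ s‖ := norm_pos_iff.2 (h.riemannZeta₁_ne_zero (by linarith))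
  have him : 1 + s.im ^ 2 ≤ (1 + |s.im|) ^ 2 := by nlinarith [abs_nonneg s.im, sq_abs s.im]
  rw [moebiusExpMellin, norm_div, norm_mul, ← div_eq_mul_inv,
    div_le_div_iff₀ (by positivity) (by positivity)]
  calc ‖Complex.Gamma (2 - s)‖ * (1 + s.im ^ 2)
      ≤ ‖Complex.Gamma (2 - s)‖ * (1 + |s.im|) ^ 2 * 1 := by rw [mul_one]; gcongr
    _ ≤ ‖Complex.Gamma (2 - s)‖ * (1 + |s.im|) ^ 2 *
          (‖s‖ / a * (C * (1 + |s.im|) ^ A * ‖riemannZeta₁ s‖)) := by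
        gcongr
        exact one_le_mul_of_one_le_of_one_le ((one_le_div h0).2 hs) hζ_low
    _ = ‖Complex.Gamma (2 - s)‖ * (1 + |s.im|) ^ (A + 2) *
          (C / a * (‖s‖ * ‖riemannZeta₁ s‖)) := by ring
    _ ≤ B * (C / a * (‖s‖ * ‖riemannZeta₁ s‖)) := by gcongr
    _ = B * (C / a) * (‖s‖ * ‖riemannZeta₁ s‖) := by ring

/-! ### Contour shift -/

section VerticalLine

variable {E : Type*} [NormedAddCommGroup E] {f : ℂ → E} {a b c C : ℝ}

lemma integrable_vertical_of_norm_le (hf : ContinuousOn f {z | z.re = c})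
    (hC : ∀ z : ℂ, z.re = c → ‖f z‖ ≤ C * (1 + z.im ^ 2)⁻¹) :
    Integrable fun y : ℝ ↦ f (c + y * Complex.I) := by
  refine (integrable_inv_one_add_sq.const_mul C).mono' ?_ (Eventually.of_forall fun y ↦ ?_)
  · exact (hf.comp_continuous (by fun_prop) fun y ↦ by simp).aestronglyMeasurable
  · simpa using hC (c + y * Complex.I) (by simp)

variable [NormedSpace ℂ E]

lemma tendsto_integral_horizontal_of_norm_le {ψ : ℝ → ℝ} (hab : a ≤ b)
    (hC : ∀ z : ℂ, a ≤ z.re → z.re ≤ b → ‖f z‖ ≤ C * (1 + z.im ^ 2)⁻¹)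
    (hψ : Tendsto (fun T ↦ ψ T ^ 2) atTop atTop) :
    Tendsto (fun T ↦ ∫ x in a..b, f (x + ψ T * Complex.I)) atTop (𝓝 0) := by
  have hbound : Tendsto (fun T ↦ C * (1 + ψ T ^ 2)⁻¹ * |b - a|) atTop (𝓝 0) := by
    simpa using (((tendsto_atTop_add_const_left _ 1 hψ).inv_tendsto_atTop.const_mul C).mul_const
      |b - a|)
  refine squeeze_zero_norm (fun T ↦ ?_) hbound
  refine intervalIntegral.norm_integral_le_of_norm_le_const fun x hx ↦ ?_
  rw [uIoc_of_le hab] at hx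
  simpa using hC (x + ψ T * Complex.I) (by simpa using hx.1.le) (by simpa using hx.2)

lemma integral_vertical_eq_of_norm_le (hab : a ≤ b)
    (hf : DifferentiableOn ℂ f {z | a ≤ z.re ∧ z.re ≤ b})
    (hC : ∀ z : ℂ, a ≤ z.re → z.re ≤ b → ‖f z‖ ≤ C * (1 + z.im ^ 2)⁻¹) :
    ∫ y : ℝ, f (a + y * Complex.I) = ∫ y : ℝ, f (b + y * Complex.I) := by
  have hvert {c : ℝ} (hac : a ≤ c) (hcb : c ≤ b) :
      Tendsto (fun T : ℝ ↦ ∫ y in -T..T, f (c + y * Complex.I)) atTop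
        (𝓝 (∫ y : ℝ, f (c + y * Complex.I))) := by
    refine intervalIntegral_tendsto_integral (integrable_vertical_of_norm_le (C := C) ?_ ?_)
      tendsto_neg_atTop_atBot tendsto_id
    · exact hf.continuousOn.mono fun z hz ↦ ⟨hac.trans_eq hz.symm, hz.trans_le hcb⟩
    · exact fun z hz ↦ hC z (hac.trans_eq hz.symm) (hz.trans_le hcb)
  have hsq : Tendsto (fun T : ℝ ↦ T ^ 2) atTop atTop := tendsto_pow_atTop two_ne_zero
  have hrect (T : ℝ) : (∫ x in a..b, f (x + (-T : ℝ) * Complex.I)) -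
      (∫ x in a..b, f (x + T * Complex.I)) + Complex.I • (∫ y in -T..T, f (b + y * Complex.I)) -
      Complex.I • (∫ y in -T..T, f (a + y * Complex.I)) = 0 := by
    have hcauchy := Complex.integral_boundary_rect_eq_zero_of_differentiableOn f
      (a + (-T : ℝ) * Complex.I) (b + T * Complex.I) (hf.mono fun z hz ↦ by
        simpa [uIcc_of_le hab] using hz.1)
    simpa using hcauchy
  have hlim := (((tendsto_integral_horizontal_of_norm_le (ψ := fun T ↦ -T) hab hC
    (by simp)).sub (tendsto_integral_horizontal_of_norm_le (ψ := id) hab hC hsq)).add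
    ((hvert hab le_rfl).const_smul Complex.I)).sub ((hvert le_rfl hab).const_smul Complex.I)
  have hzero := tendsto_nhds_unique (hlim.congr hrect) tendsto_const_nhds
  rw [sub_zero, zero_add, ← smul_sub, smul_eq_zero_iff_right Complex.I_ne_zero, sub_eq_zero]
    at hzero
  exact hzero.symm

end VerticalLine

lemma moebiusExpSum_eq_integral {x c : ℝ} (hx : 0 < x) (h1 : 1 < c) (h2 : c < 2) :
    moebiusExpSum x = (1 / (2 * Real.pi)) • ∫ y : ℝ,
      (x : ℂ) ^ (c + y * Complex.I) * moebiusExpMellin (c + y * Complex.I) := by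
  have hmellin (y : ℝ) : mellin moebiusExpSum ((-c : ℝ) + (-y : ℝ) * Complex.I) =
      moebiusExpMellin (c + y * Complex.I) := by
    rw [← mellin_moebiusExpSum_eq_moebiusExpMellin (by simpa) (by simpa)]
    congr 1
    push_cast
    ring
  have hconv : MellinConvergent moebiusExpSum (-c : ℝ) := by
    obtain ⟨d, hd1, hdc⟩ := exists_between h1
    refine mellinConvergent_of_isBigO_rpow (a := -d) (b := -2) locallyIntegrableOn_moebiusExpSum
      ?_ (by simpa) ?_ (by simpa)
    · simpa using moebiusExpSum_isBigO_rpow (eventually_gt_atTop 0) hd1 (hdc.trans h2).le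
    · rw [neg_neg]
      exact moebiusExpSum_isBigO_rpow self_mem_nhdsWithin one_lt_two le_rfl
  have hvert : Complex.VerticalIntegrable (mellin moebiusExpSum) (-c) := by
    obtain ⟨C, hC⟩ :=
      zetaZeroFreeRightOf_one.exists_norm_moebiusExpMellin_le one_pos le_rfl h1 h2
    have hline : Integrable fun y : ℝ ↦ moebiusExpMellin (c + y * Complex.I) :=
      integrable_vertical_of_norm_le
        (fun z hz ↦ (zetaZeroFreeRightOf_one.differentiableAt_moebiusExpMellin zero_le_one
          (h1.trans_eq hz.symm) (hz.trans_lt h2)).continuousAt.continuousWithinAt)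
        fun z hz ↦ hC z hz.ge hz.le
    simpa only [Complex.VerticalIntegrable, ← hmellin, neg_neg] using hline.comp_neg
  have hinv := mellinInv_mellin_eq (-c) moebiusExpSum hx hconv hvert
    (continuousOn_moebiusExpSum.continuousAt (Ioi_mem_nhds hx))
  rw [← hinv, mellinInv, ← integral_neg_eq_self]
  simp only [hmellin, smul_eq_mul]
  congr! 5
  push_cast
  ring

lemma ZetaZeroFreeRightOf.moebiusExpSum_isBigO_atTop {a b : ℝ} (h : ZetaZeroFreeRightOf a)
    (h0 : 0 < a) (h1 : a ≤ 1) (hab : a < b) (hb : b ≤ 3 / 2) :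
    moebiusExpSum =O[atTop] fun x ↦ x ^ b := by
  obtain ⟨C, hC⟩ := h.exists_norm_moebiusExpMellin_le (c := 3 / 2) h0 h1 hab (by norm_num)
  refine IsBigO.of_bound (1 / (2 * Real.pi) * (C * Real.pi)) ?_
  filter_upwards [eventually_ge_atTop 1] with x hx
  have hx0 : 0 < x := by linarith
  have hnorm (s : ℂ) (hbs : b ≤ s.re) (hs : s.re ≤ 3 / 2) :
      ‖(x : ℂ) ^ s * moebiusExpMellin s‖ ≤ x ^ s.re * (C * (1 + s.im ^ 2)⁻¹) := by
    rw [norm_mul, Complex.norm_cpow_eq_rpow_re_of_pos hx0]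
    gcongr
    exact hC s hbs hs
  have hshift := integral_vertical_eq_of_norm_le (f := fun s ↦ (x : ℂ) ^ s * moebiusExpMellin s)
    (C := x ^ (3 / 2 : ℝ) * C) hb
    (fun s hs ↦ ((differentiableAt_id.const_cpow (Or.inl (Complex.ofReal_ne_zero.2 hx0.ne'))).mul
      (h.differentiableAt_moebiusExpMellin h0.le (by linarith [hs.1])
        (by linarith [hs.2]))).differentiableWithinAt)
    (fun s hbs hs ↦ (hnorm s hbs hs).trans (by
      rw [mul_assoc]
      gcongr
      exact (norm_nonneg _).trans (hC s hbs hs)))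
  have hmajorant : ∫ y : ℝ, x ^ b * (C * (1 + y ^ 2)⁻¹) = C * Real.pi * x ^ b := by
    rw [integral_const_mul, integral_const_mul, integral_univ_inv_one_add_sq]
    ring
  rw [moebiusExpSum_eq_integral (c := 3 / 2) hx0 (by norm_num) (by norm_num), ← hshift, norm_smul,
    Real.norm_of_nonneg (by positivity), Real.norm_of_nonneg (by positivity), mul_assoc,
    ← hmajorant]
  gcongr
  refine norm_integral_le_of_norm_le ((integrable_inv_one_add_sq.const_mul C).const_mul _)
    (Eventually.of_forall fun y ↦ ?_)
  simpa using hnorm (b + y * Complex.I) (by simp) (by simpa using hb)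

lemma zetaZeroFreeRightOf_iff_moebiusExpSum_isBigO {θ : ℝ} (hθ : 0 ≤ θ) :
    ZetaZeroFreeRightOf θ ↔
      ∀ ε : ℝ, 0 < ε → moebiusExpSum =O[atTop] fun x : ℝ ↦ x ^ (θ + ε) := by
  refine ⟨fun h ε hε ↦ ?_, fun h s hs ↦ ?_⟩
  · have hfree : ZetaZeroFreeRightOf (min (θ + ε / 2) 1) := by
      rcases min_choice (θ + ε / 2) 1 with hmin | hmin <;> rw [hmin]
      · exact h.mono (by linarith)
      · exact zetaZeroFreeRightOf_one
    refine (hfree.moebiusExpSum_isBigO_atTop (b := min (θ + ε) (3 / 2)) (by positivity)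
      (min_le_right _ _) ?_ (min_le_right _ _)).trans (isBigO_rpow_rpow_atTop (min_le_left _ _))
    exact min_lt_min (by linarith) (by norm_num)
  · exact riemannZeta_ne_zero_of_moebiusExpSum_isBigO (h ((s.re - θ) / 2) (by linarith))
      (by linarith)

theorem theorem3_general {θ : ℝ} (hθ : 0 ≤ θ) : InvZetaDiffGrowth θ ↔ ZetaZeroFreeRightOf θ :=
  (invZetaDiffGrowth_iff_moebiusExpSum_isBigO hθ).trans
    (zetaZeroFreeRightOf_iff_moebiusExpSum_isBigO hθ).symm

theorem theorem3 : FVBDHypothesis ↔ ZetaZeroFreeHalfPlane :=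
  theorem3_general (θ := 1 / 2) (by norm_num)
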